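/- **Setting.** Let $d,r,c\ge 0$. A unitary $U\in\mathbb C^{d\times d}$ is a *block encoding* of $A\in\mathbb C^{r\times c}$, via $B_L\in\mathbb C^{d\times r}$ and $B_R\in\mathbb C^{d\times c}$ with orthonormal columns, if $B_L^\dagger U B_R=A$. Put $\Pi_L=B_LB_L^\dagger$ and $\Pi_R=B_RB_R^\dagger$. For phases $\Phi=(\phi_0,\dots,\phi_n)\in\mathbb R^{n+1}$, $n\ge 0$, and $x\in[-1,1]$ let $$\mathrm{QSP}(\Phi,x)=e^{i\phi_0\sigma_z}\prod_{j=1}^n R(x)\,e^{i\phi_j\sigma_z},\qquad R(x)=\begin{pmatrix}x&\sqrt{1-x^2}\\ \sqrt{1-x^2}&-x\end{pmatrix},\quad \sigma_z=\begin{pmatrix}1&0\\0&-1\end{pmatrix},$$ all products being taken in order from left to right. We say that $\Phi$ realises $p\in\mathbb C[x]$ if the top left entry of $\mathrm{QSP}(\Phi,x)$ is $p(x)$ for every $x\in[-1,1]$. The *phased alternating sequence* is $$U_\Phi=\begin{cases}e^{i\phi_0(2\Pi_L-I)}\,U\,e^{i\phi_1(2\Pi_R-I)}\displaystyle\prod_{j=1}^{(n-1)/2}U^\dagger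 e^{i\phi_{2j}(2\Pi_L-I)}\,U\,e^{i\phi_{2j+1}(2\Pi_R-I)}& n\text{ odd},\\[2ex] e^{i\phi_0(2\Pi_R-I)}\displaystyle\prod_{j=1}^{n/2}U^\dagger e^{i\phi_{2j-1}(2\Pi_L-I)}\,U\,e^{i\phi_{2j}(2\Pi_R-I)}& n\text{ even}.\end{cases}$$ For a matrix $M\in\mathbb C^{a\times b}$ with singular value decomposition $M=\sum_{i\le\min(a,b)}\sigma_iu_iv_i^\dagger$ (with $(u_i)_{i\le a}$, $(v_i)_{i\le b}$ orthonormal bases of $\mathbb C^a$, $\mathbb C^b$, $\sigma_i\ge0$, and $\sigma_i=0$ for $i>\min(a,b)$) and $f:\mathbb R\to\mathbb C$, let $$f^{(SV)}(M)=\sum_{i\le\min(a,b)}f(\sigma_i)u_iv_i^\dagger\ \text{ if } f \text{ is odd},\qquad f^{(SV)}(M)=\sum_{i\le b}f(\sigma_i)v_iv_i^\dagger\ \text{ if } f\text{ is even}.$$ This does not depend on the chosen decomposition. **Theorem 2.6.** Let $U$ be a block encoding of $A$ via $B_L,B_R$, and let $\Phi\in\mathbb R^{n+1}$ realise $p\in\mathbb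 C[x]$. Then $p$ is odd or even, as a function on $\mathbb R$, and $U_\Phi$ is a block encoding of $p^{(SV)}(A)$. Precisely: * If $p$ is odd, then $U_\Phi$ is a block encoding of $p^{(SV)}(A)$ via $B_L,B_R$, and $$\Pi_LU_\Phi\Pi_R=\begin{pmatrix}p^{(SV)}(A)&0\\0&0\end{pmatrix}=p^{(SV)}(\Pi_LU\Pi_R).$$ * If $p$ is even, then $U_\Phi$ is a block encoding of $p^{(SV)}(A)$ via $B_R,B_R$, and $$\Pi_RU_\Phi\Pi_R=\begin{pmatrix}p^{(SV)}(A)&0\\0&0\end{pmatrix}=\Pi_R\,p^{(SV)}(\Pi_LU\Pi_R)\,\Pi_R.$$ Here a $d\times d$ matrix is written in block form with respect to arbitrary orthonormal bases of $\mathbb C^d$ that begin with the columns of $B_L$ (odd case) or $B_R$ (even case) for the rows, and with the columns of $B_R$ for the columns. -/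

import Mathlib

open scoped Matrix

namespace QSVT

/-- A singular value decomposition `A = ∑_{i < min r c} σ i • u i (v i)ᴴ` of a complex `r × c` matrix:
`u` and `v` are orthonormal bases of `ℂ^r` and `ℂ^c`, the `σ i` are nonnegative reals, and
`σ i = 0` for `i ≥ min r c`. (Indices start at `0`. No ordering of the `σ i` is required.) -/
structure SVD {r c : ℕ} (A : Matrix (Fin r) (Fin c) ℂ) where
  σ : ℕ → ℝ
  u : OrthonormalBasis (Fin r) ℂ (EuclideanSpace ℂ (Fin r))
  v : OrthonormalBasis (Fin c) ℂ (EuclideanSpace ℂ (Fin c))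
  σ_nonneg : ∀ i, 0 ≤ σ i
  σ_eq_zero : ∀ i, min r c ≤ i → σ i = 0
  eq_sum : A = ∑ i : Fin (min r c), (σ i : ℂ) •
    Matrix.vecMulVec (u (i.castLE (min_le_left r c))).ofLp
      (star (v (i.castLE (min_le_right r c))).ofLp)

/-- `∑_{i < min r c} f (σ i) • u i (v i)ᴴ`, the value of `f^(SV)(A)` for odd `f`. -/
noncomputable def SVD.oddTransform {r c : ℕ} {A : Matrix (Fin r) (Fin c) ℂ} (D : SVD A)
    (f : ℝ → ℂ) : Matrix (Fin r) (Fin c) ℂ :=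
  ∑ i : Fin (min r c), f (D.σ i) •
    Matrix.vecMulVec (D.u (i.castLE (min_le_left r c))).ofLp
      (star (D.v (i.castLE (min_le_right r c))).ofLp)

/-- `∑_{i < c} f (σ i) • v i (v i)ᴴ`, the value of `f^(SV)(A)` for even `f`. -/
noncomputable def SVD.evenTransform {r c : ℕ} {A : Matrix (Fin r) (Fin c) ℂ} (D : SVD A)
    (f : ℝ → ℂ) : Matrix (Fin c) (Fin c) ℂ :=
  ∑ i : Fin c, f (D.σ i) • Matrix.vecMulVec (D.v i).ofLp (star (D.v i).ofLp)

theorem outer_mulVec {r c : ℕ} (x : EuclideanSpace ℂ (Fin r)) (y z : EuclideanSpace ℂ (Fin c)) :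
    Matrix.vecMulVec x.ofLp (star y.ofLp) *ᵥ z.ofLp = (inner ℂ y z) • x.ofLp := by
  rw [Matrix.vecMulVec_mulVec, EuclideanSpace.inner_eq_star_dotProduct, dotProduct_comm]
  ext i
  simp [mul_comm]

theorem eq_of_mulVec_basis {r c : ℕ} (v : OrthonormalBasis (Fin c) ℂ (EuclideanSpace ℂ (Fin c)))
    {M N : Matrix (Fin r) (Fin c) ℂ} (h : ∀ j, M *ᵥ (v j).ofLp = N *ᵥ (v j).ofLp) : M = N := by
  apply (Matrix.toEuclideanLin (𝕜 := ℂ)).injective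
  apply v.toBasis.ext
  intro j
  ext i
  have := congrFun (h j) i
  simpa [Matrix.toLpLin_apply] using this

theorem sum_outer_mulVec {r c : ℕ} (u : OrthonormalBasis (Fin r) ℂ (EuclideanSpace ℂ (Fin r)))
    (v : OrthonormalBasis (Fin c) ℂ (EuclideanSpace ℂ (Fin c))) (g : ℕ → ℂ) (j : Fin c) :
    (∑ i : Fin (min r c), g i • Matrix.vecMulVec (u (i.castLE (min_le_left r c))).ofLp
      (star (v (i.castLE (min_le_right r c))).ofLp)) *ᵥ (v j).ofLp =
      if h : (j : ℕ) < r then g j • (u ⟨j, h⟩).ofLp else 0 := by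
  simp only [Matrix.sum_mulVec, Matrix.smul_mulVec, outer_mulVec,
    orthonormal_iff_ite.mp v.orthonormal]
  split_ifs with h
  · rw [Finset.sum_eq_single (⟨j, lt_min h j.2⟩ : Fin (min r c))]
    · simp [Fin.castLE]
    · intro b _ hb
      rw [if_neg, zero_smul, smul_zero]
      intro hbj
      exact hb (Fin.ext (by simpa using congrArg Fin.val hbj))
    · simp
  · apply Finset.sum_eq_zero
    intro b _
    rw [if_neg, zero_smul, smul_zero]
    intro hbj
    exact h (by rw [← hbj]; exact b.2.trans_le (min_le_left r c))

theorem SVD.exists_svd {r c : ℕ} (A : Matrix (Fin r) (Fin c) ℂ) : Nonempty (SVD A) := by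
  classical
  set T := Matrix.toEuclideanLin A with hT
  have hc : Module.finrank ℂ (EuclideanSpace ℂ (Fin c)) = c := by simp
  have hr : Module.finrank ℂ (EuclideanSpace ℂ (Fin r)) = r := by simp
  have hS := T.isSymmetric_adjoint_comp_self
  let v := hS.eigenvectorBasis hc
  have hTT : ∀ i j, inner ℂ (T (v i)) (T (v j)) =
      if i = j then ((T.singularValues i : ℂ) ^ 2) else 0 := by
    intro i j
    rw [← LinearMap.adjoint_inner_right, ← LinearMap.comp_apply,
      hS.apply_eigenvectorBasis hc j, inner_smul_right, ← T.sq_singularValues_fin hc j,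
      orthonormal_iff_ite.mp v.orthonormal i j]
    split_ifs with h
    · subst h; simp
    · simp
  have hrank : ∀ i, r ≤ i → T.singularValues i = 0 := by
    intro i hi
    rw [T.singularValues_eq_zero_iff_le_finrank_range]
    exact (Submodule.finrank_le _).trans (hr.le.trans hi)
  let w : Fin r → EuclideanSpace ℂ (Fin r) := fun i =>
    if h : (i : ℕ) < c then ((T.singularValues i : ℂ)⁻¹) • T (v ⟨i, h⟩) else 0
  let s : Set (Fin r) := {i | (i : ℕ) < c ∧ T.singularValues i ≠ 0}
  have hw : Orthonormal ℂ (s.domRestrict w) := by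
    rw [orthonormal_iff_ite]
    rintro ⟨i, hi, hi0⟩ ⟨j, hj, hj0⟩
    simp only [Set.domRestrict_apply, w, hi, hj, dif_pos, inner_smul_left, inner_smul_right, hTT,
      Fin.mk.injEq, Subtype.mk.injEq, Fin.val_inj]
    split_ifs with h
    · subst h
      have : (T.singularValues i : ℂ) ≠ 0 := by exact_mod_cast hi0
      simp only [map_inv₀, Complex.conj_ofReal]
      field_simp
    · simp
  obtain ⟨u, hu⟩ := hw.exists_orthonormalBasis_extension_of_card_eq (by simp)
  have hTv : ∀ j : Fin c, T (v j) =
      if h : (j : ℕ) < r then (T.singularValues j : ℂ) • u ⟨j, h⟩ else 0 := by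
    intro j
    have hz : T.singularValues j = 0 → T (v j) = 0 := by
      intro h0
      have := hTT j j
      rw [if_pos rfl, h0] at this
      simpa using this
    split_ifs with h
    · by_cases h0 : T.singularValues j = 0
      · rw [hz h0, h0]; simp
      · have : (T.singularValues j : ℂ) ≠ 0 := by exact_mod_cast h0
        rw [hu ⟨j, h⟩ ⟨j.2, h0⟩]
        simp [w, this]
    · exact hz (hrank _ (not_lt.mp h))
  refine ⟨⟨T.singularValues, u, v, T.singularValues_nonneg, ?_, ?_⟩⟩
  · intro i hi
    rcases min_le_iff.mp hi with h | h
    · exact hrank i h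
    · exact T.singularValues_of_finrank_le (hc.le.trans h)
  · apply eq_of_mulVec_basis v
    intro j
    rw [sum_outer_mulVec u v (fun i => (T.singularValues i : ℂ)) j]
    have h1 : A *ᵥ (v j).ofLp = (T (v j)).ofLp := by simp [hT, Matrix.toLpLin_apply]
    rw [h1, hTv j]
    split_ifs <;> rfl

theorem SVD.mulVec_v {r c : ℕ} {A : Matrix (Fin r) (Fin c) ℂ} (D : SVD A) (j : Fin c) :
    A *ᵥ (D.v j).ofLp = if h : (j : ℕ) < r then (D.σ j : ℂ) • (D.u ⟨j, h⟩).ofLp else 0 := by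
  refine (congrArg (· *ᵥ (D.v j).ofLp) D.eq_sum).trans ?_
  exact sum_outer_mulVec D.u D.v (fun i => (D.σ i : ℂ)) j

theorem SVD.gram_mulVec_v {r c : ℕ} {A : Matrix (Fin r) (Fin c) ℂ} (D : SVD A) (j : Fin c) :
    (Aᴴ * A) *ᵥ (D.v j).ofLp = ((D.σ j : ℂ) ^ 2) • (D.v j).ofLp := by
  rw [← Matrix.mulVec_mulVec, D.mulVec_v]
  split_ifs with h
  · rw [Matrix.mulVec_smul]
    rw [show Aᴴ *ᵥ (D.u ⟨j, h⟩).ofLp = _ from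
      congrArg (fun M => Mᴴ *ᵥ (D.u ⟨j, h⟩).ofLp) D.eq_sum]
    simp only [Matrix.conjTranspose_sum, Matrix.conjTranspose_smul, Matrix.conjTranspose_vecMulVec,
      star_star, Matrix.sum_mulVec, Matrix.smul_mulVec, outer_mulVec,
      orthonormal_iff_ite.mp D.u.orthonormal]
    rw [Finset.sum_eq_single (⟨j, lt_min h j.2⟩ : Fin (min r c))]
    · ext k
      simp [Fin.castLE, sq, mul_assoc]
    · intro b _ hb
      rw [if_neg, zero_smul, smul_zero]
      intro hbj
      exact hb (Fin.ext (by simpa using congrArg Fin.val hbj))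
    · simp
  · rw [D.σ_eq_zero j ((min_le_left _ _).trans (not_lt.mp h))]
    simp

theorem SVD.aeval_gram_mulVec_v {r c : ℕ} {A : Matrix (Fin r) (Fin c) ℂ} (D : SVD A)
    (q : Polynomial ℂ) (j : Fin c) :
    (Polynomial.aeval (Aᴴ * A) q) *ᵥ (D.v j).ofLp =
      (q.eval ((D.σ j : ℂ) ^ 2)) • (D.v j).ofLp := by
  induction q using Polynomial.induction_on' with
  | add p q hp hq => simp [Matrix.add_mulVec, hp, hq, add_smul]
  | monomial n a =>
    have : ∀ n : ℕ, ((Aᴴ * A) ^ n) *ᵥ (D.v j).ofLp =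
        (((D.σ j : ℂ) ^ 2) ^ n) • (D.v j).ofLp := by
      intro n
      induction n with
      | zero => simp
      | succ n ih =>
        rw [pow_succ, ← Matrix.mulVec_mulVec, D.gram_mulVec_v, Matrix.mulVec_smul, ih, smul_smul,
          mul_comm, ← pow_succ]
    rw [Polynomial.aeval_monomial, Polynomial.eval_monomial, ← Algebra.smul_def,
      Matrix.smul_mulVec, this, smul_smul]

theorem SVD.evenTransform_eq_aeval {r c : ℕ} {A : Matrix (Fin r) (Fin c) ℂ} (D : SVD A)
    {f : ℝ → ℂ} {q : Polynomial ℂ} (h : ∀ j : Fin c, q.eval ((D.σ j : ℂ) ^ 2) = f (D.σ j)) :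
    D.evenTransform f = Polynomial.aeval (Aᴴ * A) q := by
  apply eq_of_mulVec_basis D.v
  intro j
  rw [D.aeval_gram_mulVec_v, h, SVD.evenTransform]
  simp only [Matrix.sum_mulVec, Matrix.smul_mulVec, outer_mulVec,
    orthonormal_iff_ite.mp D.v.orthonormal]
  rw [Finset.sum_eq_single j] <;> simp +contextual

theorem SVD.oddTransform_eq_aeval {r c : ℕ} {A : Matrix (Fin r) (Fin c) ℂ} (D : SVD A)
    {f : ℝ → ℂ} {q : Polynomial ℂ}
    (h : ∀ j : Fin c, (D.σ j : ℂ) * q.eval ((D.σ j : ℂ) ^ 2) = f (D.σ j)) :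
    D.oddTransform f = A * Polynomial.aeval (Aᴴ * A) q := by
  apply eq_of_mulVec_basis D.v
  intro j
  rw [← Matrix.mulVec_mulVec, D.aeval_gram_mulVec_v, Matrix.mulVec_smul, D.mulVec_v,
    SVD.oddTransform, sum_outer_mulVec D.u D.v (fun i => f (D.σ i)) j]
  split_ifs with hj
  · rw [smul_smul, ← h, mul_comm]
  · simp

theorem exists_interpolation {r c : ℕ} {A : Matrix (Fin r) (Fin c) ℂ} (D D' : SVD A) (g : ℝ → ℂ) :
    ∃ q : Polynomial ℂ, (∀ j : Fin c, q.eval ((D.σ j : ℂ) ^ 2) = g (D.σ j)) ∧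
      ∀ j : Fin c, q.eval ((D'.σ j : ℂ) ^ 2) = g (D'.σ j) := by
  classical
  let S : Finset ℝ := (Finset.univ.image fun j : Fin c => D.σ j) ∪
    (Finset.univ.image fun j : Fin c => D'.σ j)
  have hS : ∀ x ∈ S, 0 ≤ x := by
    intro x hx
    simp only [S, Finset.mem_union, Finset.mem_image, Finset.mem_univ, true_and] at hx
    rcases hx with ⟨j, rfl⟩ | ⟨j, rfl⟩
    · exact D.σ_nonneg _
    · exact D'.σ_nonneg _
  have hinj : Set.InjOn (fun x : ℝ => (x : ℂ) ^ 2) S := by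
    intro x hx y hy hxy
    have hxy' : (x : ℂ) ^ 2 = (y : ℂ) ^ 2 := hxy
    have : x ^ 2 = y ^ 2 := by exact_mod_cast hxy'
    exact (sq_eq_sq₀ (hS x hx) (hS y hy)).mp this
  refine ⟨Lagrange.interpolate S (fun x : ℝ => (x : ℂ) ^ 2) g, fun j => ?_, fun j => ?_⟩
  · exact Lagrange.eval_interpolate_at_node g hinj (i := D.σ j) (by simp [S])
  · exact Lagrange.eval_interpolate_at_node g hinj (i := D'.σ j) (by simp [S])

/-- The value for even `f` does not depend on the chosen singular value decomposition. -/
theorem SVD.evenTransform_unique {r c : ℕ} {A : Matrix (Fin r) (Fin c) ℂ} (D D' : SVD A)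
    (f : ℝ → ℂ) : D.evenTransform f = D'.evenTransform f := by
  obtain ⟨q, h, h'⟩ := exists_interpolation D D' f
  rw [D.evenTransform_eq_aeval h, D'.evenTransform_eq_aeval h']

/-- The value for odd `f` does not depend on the chosen singular value decomposition. -/
theorem SVD.oddTransform_unique {r c : ℕ} {A : Matrix (Fin r) (Fin c) ℂ} (D D' : SVD A)
    {f : ℝ → ℂ} (hf : Function.Odd f) : D.oddTransform f = D'.oddTransform f := by
  have h0 : f 0 = 0 := by
    have h := hf 0
    rw [neg_zero] at h
    exact CharZero.eq_neg_self_iff.mp h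
  have hdiv : ∀ x : ℝ, (x : ℂ) * (f x / x) = f x := by
    intro x
    by_cases hx : x = 0
    · subst hx; simp [h0]
    · have : (x : ℂ) ≠ 0 := by exact_mod_cast hx
      field_simp
  obtain ⟨q, h, h'⟩ := exists_interpolation D D' (fun x => f x / x)
  rw [D.oddTransform_eq_aeval (fun j => by rw [h]; exact hdiv _),
    D'.oddTransform_eq_aeval (fun j => by rw [h']; exact hdiv _)]

/-- The singular value transform `f^(SV)(A)` of an odd function `f`; an `r × c` matrix. -/
noncomputable def svTransformOdd {r c : ℕ} (f : ℝ → ℂ) (A : Matrix (Fin r) (Fin c) ℂ) :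
    Matrix (Fin r) (Fin c) ℂ :=
  (Classical.choice (SVD.exists_svd A)).oddTransform f

/-- The singular value transform `f^(SV)(A)` of an even function `f`; a `c × c` matrix. -/
noncomputable def svTransformEven {r c : ℕ} (f : ℝ → ℂ) (A : Matrix (Fin r) (Fin c) ℂ) :
    Matrix (Fin c) (Fin c) ℂ :=
  (Classical.choice (SVD.exists_svd A)).evenTransform f

/-- Any singular value decomposition of `A` computes `f^(SV)(A)` for odd `f`. -/
theorem svTransformOdd_eq {r c : ℕ} {A : Matrix (Fin r) (Fin c) ℂ} (D : SVD A)
    {f : ℝ → ℂ} (hf : Function.Odd f) : svTransformOdd f A = D.oddTransform f :=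
  SVD.oddTransform_unique _ D hf

/-- Any singular value decomposition of `A` computes `f^(SV)(A)` for even `f`. -/
theorem svTransformEven_eq {r c : ℕ} {A : Matrix (Fin r) (Fin c) ℂ} (D : SVD A)
    (f : ℝ → ℂ) : svTransformEven f A = D.evenTransform f :=
  SVD.evenTransform_unique _ D f

/-- `U` is a block encoding of the `r × c` matrix `A`, witnessed by `BL` and `BR`: `U` is unitary,
`BL` and `BR` have orthonormal columns, and `BLᴴ * U * BR = A`. -/
structure IsBlockEncoding {d r c : ℕ} (U : Matrix (Fin d) (Fin d) ℂ) (A : Matrix (Fin r) (Fin c) ℂ)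
    (BL : Matrix (Fin d) (Fin r) ℂ) (BR : Matrix (Fin d) (Fin c) ℂ) : Prop where
  unitary : U ∈ Matrix.unitaryGroup (Fin d) ℂ
  left_orthonormal : BLᴴ * BL = 1
  right_orthonormal : BRᴴ * BR = 1
  encodes : BLᴴ * U * BR = A

/-- The square matrix `(B₁ B₂)` is unitary. -/
def IsUnitaryCompletion {d r s : ℕ} (B₁ : Matrix (Fin d) (Fin r) ℂ) (B₂ : Matrix (Fin d) (Fin s) ℂ) :
    Prop :=
  (Matrix.fromCols B₁ B₂)ᴴ * Matrix.fromCols B₁ B₂ = 1 ∧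
    Matrix.fromCols B₁ B₂ * (Matrix.fromCols B₁ B₂)ᴴ = 1

/-- `M` has the block form `(N 0; 0 0)` with respect to the bases that start with the columns of
`BL` (for the rows) and of `BR` (for the columns), whatever the unitary completions. -/
def HasBlockForm {d r c : ℕ} (M : Matrix (Fin d) (Fin d) ℂ) (N : Matrix (Fin r) (Fin c) ℂ)
    (BL : Matrix (Fin d) (Fin r) ℂ) (BR : Matrix (Fin d) (Fin c) ℂ) : Prop :=
  ∀ (s t : ℕ) (BL₂ : Matrix (Fin d) (Fin s) ℂ) (BR₂ : Matrix (Fin d) (Fin t) ℂ),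
    IsUnitaryCompletion BL BL₂ → IsUnitaryCompletion BR BR₂ →
      (Matrix.fromCols BL BL₂)ᴴ * M * Matrix.fromCols BR BR₂ = Matrix.fromBlocks N 0 0 0

/-- The rotation `exp(i t σ_z)`. -/
noncomputable def zRotation (t : ℝ) : Matrix (Fin 2) (Fin 2) ℂ :=
  !![Complex.exp (Complex.I * t), 0; 0, Complex.exp (-(Complex.I * t))]

/-- The reflection `R(x)`, for `x ∈ [-1, 1]`. -/
noncomputable def signalReflection (x : ℝ) : Matrix (Fin 2) (Fin 2) ℂ :=
  !![(x : ℂ), (Real.sqrt (1 - x ^ 2) : ℂ); (Real.sqrt (1 - x ^ 2) : ℂ), -(x : ℂ)]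

/-- The quantum signal processing circuit `exp(i φ₀ σ_z) ∏_{j=1}^n R(x) exp(i φ_j σ_z)` (factors in
order from left to right) of the phase factors `φ 0, …, φ n`. -/
noncomputable def qsp (n : ℕ) (φ : ℕ → ℝ) (x : ℝ) : Matrix (Fin 2) (Fin 2) ℂ :=
  zRotation (φ 0) *
    ((List.range n).map fun k => signalReflection x * zRotation (φ (k + 1))).prod

/-- The phase factors `φ 0, …, φ n` realise the polynomial `p`: for every `x ∈ [-1, 1]` the top left
entry of the circuit is `p(x)`. -/
def Realises (n : ℕ) (φ : ℕ → ℝ) (p : Polynomial ℂ) : Prop :=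
  ∀ x ∈ Set.Icc (-1 : ℝ) 1, qsp n φ x 0 0 = p.eval (x : ℂ)

/-- The matrix exponential `exp(i t (2 P - I))`. -/
noncomputable def projectorPhase {d : ℕ} (P : Matrix (Fin d) (Fin d) ℂ) (t : ℝ) :
    Matrix (Fin d) (Fin d) ℂ :=
  NormedSpace.exp ((Complex.I * (t : ℂ)) • ((2 : ℂ) • P - 1))

/-- The phased alternating sequence `U_Φ` of `U` and the projections `PL`, `PR`, for the phase
factors `φ 0, …, φ n`; all products are taken in order from left to right. In the list products
the factor with index `k` is the one usually written with `j = k + 1`. For even `n` the sequence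
maps the domain of `U` to itself, so it starts with a phase of `PR`. -/
noncomputable def phasedSequence {d : ℕ} (U PL PR : Matrix (Fin d) (Fin d) ℂ) (n : ℕ) (φ : ℕ → ℝ) :
    Matrix (Fin d) (Fin d) ℂ :=
  if Odd n then
    projectorPhase PL (φ 0) * U * projectorPhase PR (φ 1) *
      ((List.range ((n - 1) / 2)).map fun k =>
        Uᴴ * projectorPhase PL (φ (2 * (k + 1))) * U * projectorPhase PR (φ (2 * (k + 1) + 1))).prod
  else
    projectorPhase PR (φ 0) *
      ((List.range (n / 2)).map fun k =>
        Uᴴ * projectorPhase PL (φ (2 * k + 1)) * U * projectorPhase PR (φ (2 * k + 2))).prod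

end QSVT

namespace QSVT

open Polynomial

/-! Write `G = Aᴴ * A` and `s = √(1 - x²)`. No decomposition of `ℂ^d` into two-dimensional invariant
subspaces is used; instead the columns `U_Φ * BR` are computed as polynomials in `G`. For even `n`
they have the form `BR P(G) + (Uᴴ BL A - BR G) Q(G)`, for odd `n` the form `BL A P(G) + (U BR - BL
A) Q(G)`. In each case the projection of the leftmost phase fixes the first summand and kills the
second, so a phase only multiplies them by `exp(±iφ)`, while `U` and `Uᴴ` turn one form into the
other. The first column of the QSP circuit, written `(P(x²), s x Q(x²))` or `(x P(x²), s Q(x²))`,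
obeys the same recursion for `P` and `Q`: on a right singular vector with singular value `x` the two
residual terms have norms `s x` and `s`. This is `evenForm_succ` and `oddForm_succ`. Hence `p` is
`P(x²)` or `x P(x²)`, which gives the parity, and compressing `U_Φ * BR` by `BRᴴ` or `BLᴴ` removes
the residual and leaves `P(G)` or `A P(G)`, that is `p^(SV)(A)`. For the projected matrices, `Π_L U
Π_R = BL A BRᴴ` has Gram matrix `BR G BRᴴ`, which `BR` intertwines with `G`. -/

/-! ### Projector phases -/

/-- For an idempotent `P`, the ring homomorphism `(a, b) ↦ a • P + b • (1 - P)`. -/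
noncomputable def idempotentHom {d : ℕ} {P : Matrix (Fin d) (Fin d) ℂ} (hP : P * P = P) :
    ℂ × ℂ →+* Matrix (Fin d) (Fin d) ℂ where
  toFun a := a.1 • P + a.2 • (1 - P)
  map_one' := by simp
  map_zero' := by simp
  map_add' a b := by simp only [Prod.fst_add, Prod.snd_add, add_smul]; abel
  map_mul' a b := by
    have h1 : P * (1 - P) = 0 := by rw [mul_sub, hP, mul_one, sub_self]
    have h2 : (1 - P) * P = 0 := by rw [sub_mul, hP, one_mul, sub_self]
    have h3 : (1 - P) * (1 - P) = 1 - P := by rw [mul_sub, h2, mul_one, sub_zero]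
    simp only [Prod.fst_mul, Prod.snd_mul, add_mul, mul_add, smul_mul_assoc, mul_smul_comm, h1, h2,
      h3, hP, smul_zero, add_zero, zero_add, smul_smul, mul_comm]

open scoped Matrix.Norms.Operator in
-- A continuous ring homomorphism commutes with the exponential, so the matrix exponential is
-- computed componentwise in `ℂ × ℂ`.
theorem projectorPhase_eq {d : ℕ} {P : Matrix (Fin d) (Fin d) ℂ} (hP : P * P = P) (t : ℝ) :
    projectorPhase P t =
      Complex.exp (Complex.I * t) • P + Complex.exp (-(Complex.I * t)) • (1 - P) := by
  have hcont : Continuous (idempotentHom hP) := by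
    change Continuous fun a : ℂ × ℂ => a.1 • P + a.2 • (1 - P)
    fun_prop
  have h := NormedSpace.map_exp (idempotentHom hP) hcont
    ((Complex.I * t, -(Complex.I * t)) : ℂ × ℂ)
  have harg : idempotentHom hP (Complex.I * t, -(Complex.I * t)) =
      (Complex.I * (t : ℂ)) • ((2 : ℂ) • P - 1) := by
    change (Complex.I * t) • P + (-(Complex.I * t)) • (1 - P) = _
    module
  rw [harg] at h
  refine h.symm.trans ?_
  change (NormedSpace.exp _ : ℂ × ℂ).1 • P + (NormedSpace.exp _ : ℂ × ℂ).2 • (1 - P) = _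
  rw [Prod.fst_exp, Prod.snd_exp, Complex.exp_eq_exp_ℂ]

theorem projectorPhase_mul_of_fixed {d k : ℕ} {P : Matrix (Fin d) (Fin d) ℂ} (hP : P * P = P)
    (t : ℝ) {X : Matrix (Fin d) (Fin k) ℂ} (hX : P * X = X) :
    projectorPhase P t * X = Complex.exp (Complex.I * t) • X := by
  rw [projectorPhase_eq hP, Matrix.add_mul, Matrix.smul_mul, Matrix.smul_mul, Matrix.sub_mul, hX,
    Matrix.one_mul, sub_self, smul_zero, add_zero]

theorem projectorPhase_mul_of_killed {d k : ℕ} {P : Matrix (Fin d) (Fin d) ℂ} (hP : P * P = P)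
    (t : ℝ) {X : Matrix (Fin d) (Fin k) ℂ} (hX : P * X = 0) :
    projectorPhase P t * X = Complex.exp (-(Complex.I * t)) • X := by
  rw [projectorPhase_eq hP, Matrix.add_mul, Matrix.smul_mul, Matrix.smul_mul, Matrix.sub_mul, hX,
    Matrix.one_mul, sub_zero, smul_zero, zero_add]

/-- The exponent is skew-Hermitian and commutes with its negative. -/
theorem projectorPhase_mem_unitaryGroup {d : ℕ} {P : Matrix (Fin d) (Fin d) ℂ} (hP : Pᴴ = P)
    (t : ℝ) : projectorPhase P t ∈ Matrix.unitaryGroup (Fin d) ℂ := by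
  rw [Matrix.mem_unitaryGroup_iff', Matrix.star_eq_conjTranspose, projectorPhase,
    ← Matrix.exp_conjTranspose]
  have h : ((Complex.I * (t : ℂ)) • ((2 : ℂ) • P - 1))ᴴ =
      -((Complex.I * (t : ℂ)) • ((2 : ℂ) • P - 1)) := by
    simp [Matrix.conjTranspose_smul, Matrix.conjTranspose_sub, hP]
  generalize (Complex.I * (t : ℂ)) • ((2 : ℂ) • P - 1) = M at h ⊢
  rw [h, ← Matrix.exp_add_of_commute _ _ (Commute.refl M).neg_left, neg_add_cancel,
    NormedSpace.exp_zero]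

/-! ### Recursions for the two circuits -/

theorem qsp_succ (n : ℕ) (φ : ℕ → ℝ) (x : ℝ) :
    qsp (n + 1) φ x = zRotation (φ 0) * (signalReflection x * qsp n (fun k => φ (k + 1)) x) := by
  simp only [qsp, List.range_succ_eq_map, List.map_cons, List.map_map, List.prod_cons, mul_assoc]
  rfl

theorem qsp_succ_zero_zero (n : ℕ) (φ : ℕ → ℝ) (x : ℝ) :
    qsp (n + 1) φ x 0 0 = Complex.exp (Complex.I * φ 0) *
      (x * qsp n (fun k => φ (k + 1)) x 0 0 +
        (Real.sqrt (1 - x ^ 2) : ℂ) * qsp n (fun k => φ (k + 1)) x 1 0) := by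
  rw [qsp_succ]
  simp only [zRotation, signalReflection, Matrix.mul_apply, Fin.sum_univ_two]
  simp

theorem qsp_succ_one_zero (n : ℕ) (φ : ℕ → ℝ) (x : ℝ) :
    qsp (n + 1) φ x 1 0 = Complex.exp (-(Complex.I * φ 0)) *
      ((Real.sqrt (1 - x ^ 2) : ℂ) * qsp n (fun k => φ (k + 1)) x 0 0 -
        x * qsp n (fun k => φ (k + 1)) x 1 0) := by
  rw [qsp_succ]
  simp only [zRotation, signalReflection, Matrix.mul_apply, Fin.sum_univ_two]
  simp [sub_eq_add_neg]

variable {d : ℕ} (U PL PR : Matrix (Fin d) (Fin d) ℂ)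

theorem phasedSequence_zero (φ : ℕ → ℝ) :
    phasedSequence U PL PR 0 φ = projectorPhase PR (φ 0) := by
  simp [phasedSequence]

/-- Factors are peeled off on the left: sequences of both parities end on the right with a phase of
`PR`, and only the leftmost projection alternates. -/
theorem phasedSequence_two_mul_add_one (m : ℕ) (φ : ℕ → ℝ) :
    phasedSequence U PL PR (2 * m + 1) φ =
      projectorPhase PL (φ 0) * (U * phasedSequence U PL PR (2 * m) fun k => φ (k + 1)) := by
  have h1 : Odd (2 * m + 1) := ⟨m, rfl⟩
  have h2 : ¬ Odd (2 * m) := by simp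
  have h3 : (2 * m + 1 - 1) / 2 = m := by omega
  have h4 : 2 * m / 2 = m := by omega
  simp only [phasedSequence, if_pos h1, if_neg h2, h3, h4, mul_assoc]
  rfl

theorem phasedSequence_two_mul_add_two (m : ℕ) (φ : ℕ → ℝ) :
    phasedSequence U PL PR (2 * m + 1 + 1) φ =
      projectorPhase PR (φ 0) * (Uᴴ * phasedSequence U PL PR (2 * m + 1) fun k => φ (k + 1)) := by
  have h1 : Odd (2 * m + 1) := ⟨m, rfl⟩
  have h2 : ¬ Odd (2 * m + 1 + 1) := by rw [Nat.not_odd_iff_even]; exact h1.add_one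
  have h3 : (2 * m + 1 - 1) / 2 = m := by omega
  have h4 : (2 * m + 1 + 1) / 2 = m + 1 := by omega
  simp only [phasedSequence, if_pos h1, if_neg h2, h3, h4, mul_assoc, List.range_succ_eq_map,
    List.map_cons, List.map_map, List.prod_cons]
  rfl

variable {U PL PR}

theorem phasedSequence_mem_unitaryGroup (hU : U ∈ Matrix.unitaryGroup (Fin d) ℂ) (hL : PLᴴ = PL)
    (hR : PRᴴ = PR) (n : ℕ) (φ : ℕ → ℝ) :
    phasedSequence U PL PR n φ ∈ Matrix.unitaryGroup (Fin d) ℂ := by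
  induction n generalizing φ with
  | zero =>
    rw [phasedSequence_zero]
    exact projectorPhase_mem_unitaryGroup hR _
  | succ n ih =>
    rcases Nat.even_or_odd' n with ⟨m, rfl | rfl⟩
    · rw [phasedSequence_two_mul_add_one]
      exact mul_mem (projectorPhase_mem_unitaryGroup hL _) (mul_mem hU (ih _))
    · rw [phasedSequence_two_mul_add_two]
      exact mul_mem (projectorPhase_mem_unitaryGroup hR _) (mul_mem (Unitary.star_mem hU) (ih _))

/-! ### The polynomials computed by a sequence of phases -/

/-- `P` and `Q` describe both the first column of the circuit with an even number `n` of
reflections and the action of the phased sequence on the columns of `BR`. -/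
def EvenForm {d r c : ℕ} (U : Matrix (Fin d) (Fin d) ℂ) (A : Matrix (Fin r) (Fin c) ℂ)
    (BL : Matrix (Fin d) (Fin r) ℂ) (BR : Matrix (Fin d) (Fin c) ℂ) (n : ℕ) (φ : ℕ → ℝ)
    (P Q : ℂ[X]) : Prop :=
  (∀ x ∈ Set.Icc (-1 : ℝ) 1, qsp n φ x 0 0 = P.eval ((x : ℂ) ^ 2) ∧
    qsp n φ x 1 0 = (Real.sqrt (1 - x ^ 2) : ℂ) * (x * Q.eval ((x : ℂ) ^ 2))) ∧
  phasedSequence U (BL * BLᴴ) (BR * BRᴴ) n φ * BR =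
    BR * aeval (Aᴴ * A) P + (Uᴴ * BL * A - BR * (Aᴴ * A)) * aeval (Aᴴ * A) Q

/-- The analogue of `EvenForm` for an odd number of reflections. -/
def OddForm {d r c : ℕ} (U : Matrix (Fin d) (Fin d) ℂ) (A : Matrix (Fin r) (Fin c) ℂ)
    (BL : Matrix (Fin d) (Fin r) ℂ) (BR : Matrix (Fin d) (Fin c) ℂ) (n : ℕ) (φ : ℕ → ℝ)
    (P Q : ℂ[X]) : Prop :=
  (∀ x ∈ Set.Icc (-1 : ℝ) 1, qsp n φ x 0 0 = x * P.eval ((x : ℂ) ^ 2) ∧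
    qsp n φ x 1 0 = (Real.sqrt (1 - x ^ 2) : ℂ) * Q.eval ((x : ℂ) ^ 2)) ∧
  phasedSequence U (BL * BLᴴ) (BR * BRᴴ) n φ * BR =
    BL * A * aeval (Aᴴ * A) P + (U * BR - BL * A) * aeval (Aᴴ * A) Q

variable {r c : ℕ} {A : Matrix (Fin r) (Fin c) ℂ} {BL : Matrix (Fin d) (Fin r) ℂ}
  {BR : Matrix (Fin d) (Fin c) ℂ}

theorem mul_conjTranspose_self_idem {k : ℕ} {B : Matrix (Fin d) (Fin k) ℂ} (hB : Bᴴ * B = 1) :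
    B * Bᴴ * (B * Bᴴ) = B * Bᴴ := by
  rw [Matrix.mul_assoc, ← Matrix.mul_assoc Bᴴ, hB, Matrix.one_mul]

theorem mul_conjTranspose_mul_self {k : ℕ} {B : Matrix (Fin d) (Fin k) ℂ} (hB : Bᴴ * B = 1) :
    B * Bᴴ * B = B := by
  rw [Matrix.mul_assoc, hB, Matrix.mul_one]

theorem ofReal_sqrt_one_sub_sq_mul_self {x : ℝ} (hx : x ∈ Set.Icc (-1 : ℝ) 1) :
    (Real.sqrt (1 - x ^ 2) : ℂ) * (Real.sqrt (1 - x ^ 2) : ℂ) = 1 - (x : ℂ) ^ 2 := by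
  rw [← Complex.ofReal_mul, Real.mul_self_sqrt (by nlinarith [hx.1, hx.2])]
  push_cast
  rfl

namespace IsBlockEncoding

theorem conjTranspose_mul_self (h : IsBlockEncoding U A BL BR) : Uᴴ * U = 1 :=
  Matrix.mem_unitaryGroup_iff'.mp h.unitary

theorem self_mul_conjTranspose (h : IsBlockEncoding U A BL BR) : U * Uᴴ = 1 :=
  Matrix.mem_unitaryGroup_iff.mp h.unitary

theorem encodes_conjTranspose (h : IsBlockEncoding U A BL BR) : BRᴴ * Uᴴ * BL = Aᴴ := by
  rw [← h.encodes, Matrix.conjTranspose_mul, Matrix.conjTranspose_mul,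
    Matrix.conjTranspose_conjTranspose, Matrix.mul_assoc]

/-- `BL * A` is the projection of `U * BR` to the range of `BL`, so the difference is orthogonal to
that range. -/
theorem left_residual (h : IsBlockEncoding U A BL BR) : BLᴴ * (U * BR - BL * A) = 0 := by
  rw [Matrix.mul_sub, ← Matrix.mul_assoc, ← Matrix.mul_assoc, h.encodes, h.left_orthonormal,
    Matrix.one_mul, sub_self]

theorem right_residual (h : IsBlockEncoding U A BL BR) :
    BRᴴ * (Uᴴ * BL * A - BR * (Aᴴ * A)) = 0 := by
  rw [Matrix.mul_sub, ← Matrix.mul_assoc, ← Matrix.mul_assoc, h.encodes_conjTranspose,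
    ← Matrix.mul_assoc, h.right_orthonormal, Matrix.one_mul, sub_self]

theorem evenForm_zero (h : IsBlockEncoding U A BL BR) (φ : ℕ → ℝ) :
    EvenForm U A BL BR 0 φ (C (Complex.exp (Complex.I * φ 0))) 0 := by
  refine ⟨fun x _ => ?_, ?_⟩
  · simp [qsp, zRotation]
  · rw [phasedSequence_zero, projectorPhase_mul_of_fixed
      (mul_conjTranspose_self_idem h.right_orthonormal) _
      (mul_conjTranspose_mul_self h.right_orthonormal)]
    simp [Algebra.algebraMap_eq_smul_one]

/-- Multiplication by `U` gives `U BR (P - X Q)(G) + BL A Q(G)`; splitting `U BR` into `BL A` and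
its residual yields the new pair. In the circuit the factor `1 - X` comes from `s²`. -/
theorem oddForm_succ (h : IsBlockEncoding U A BL BR) {m : ℕ} {φ : ℕ → ℝ} {P Q : ℂ[X]}
    (hPQ : EvenForm U A BL BR (2 * m) (fun k => φ (k + 1)) P Q) :
    OddForm U A BL BR (2 * m + 1) φ (C (Complex.exp (Complex.I * φ 0)) * (P + (1 - X) * Q))
      (C (Complex.exp (-(Complex.I * φ 0))) * (P - X * Q)) := by
  refine ⟨fun x hx => ?_, ?_⟩
  · obtain ⟨h0, h1⟩ := hPQ.1 x hx
    have hs := ofReal_sqrt_one_sub_sq_mul_self hx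
    rw [qsp_succ_zero_zero, qsp_succ_one_zero, h0, h1]
    simp only [eval_mul, eval_C, eval_add, eval_sub, eval_one, eval_X]
    constructor
    · linear_combination
        Complex.exp (Complex.I * φ 0) * x * Q.eval ((x : ℂ) ^ 2) * hs
    · ring
  · have hstep : U * (BR * aeval (Aᴴ * A) P + (Uᴴ * BL * A - BR * (Aᴴ * A)) * aeval (Aᴴ * A) Q) =
        BL * A * aeval (Aᴴ * A) (P + (1 - X) * Q) +
          (U * BR - BL * A) * aeval (Aᴴ * A) (P - X * Q) := by
      have hU : U * (Uᴴ * (BL * (A * aeval (Aᴴ * A) Q))) = BL * (A * aeval (Aᴴ * A) Q) := by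
        rw [← Matrix.mul_assoc, h.self_mul_conjTranspose, Matrix.one_mul]
      simp only [map_add, map_sub, map_mul, map_one, aeval_X, Matrix.mul_add, Matrix.mul_sub,
        Matrix.sub_mul, Matrix.one_mul, Matrix.mul_assoc, hU]
      abel
    rw [phasedSequence_two_mul_add_one, Matrix.mul_assoc, Matrix.mul_assoc, hPQ.2, hstep,
      Matrix.mul_add,
      projectorPhase_mul_of_fixed (mul_conjTranspose_self_idem h.left_orthonormal),
      projectorPhase_mul_of_killed (mul_conjTranspose_self_idem h.left_orthonormal)]
    · simp only [map_mul, aeval_C, Algebra.algebraMap_eq_smul_one, Matrix.smul_mul,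
        Matrix.mul_smul, Matrix.one_mul]
    · rw [Matrix.mul_assoc, ← Matrix.mul_assoc BLᴴ, h.left_residual, Matrix.zero_mul,
        Matrix.mul_zero]
    · rw [← Matrix.mul_assoc, ← Matrix.mul_assoc, mul_conjTranspose_mul_self h.left_orthonormal]

/-- Multiplication by `Uᴴ` gives `Uᴴ BL A (P - Q)(G) + BR Q(G)`; here `Uᴴ BL A` splits into `BR G`
and its residual. -/
theorem evenForm_succ (h : IsBlockEncoding U A BL BR) {m : ℕ} {φ : ℕ → ℝ} {P Q : ℂ[X]}
    (hPQ : OddForm U A BL BR (2 * m + 1) (fun k => φ (k + 1)) P Q) :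
    EvenForm U A BL BR (2 * m + 1 + 1) φ
      (C (Complex.exp (Complex.I * φ 0)) * (X * (P - Q) + Q))
      (C (Complex.exp (-(Complex.I * φ 0))) * (P - Q)) := by
  refine ⟨fun x hx => ?_, ?_⟩
  · obtain ⟨h0, h1⟩ := hPQ.1 x hx
    have hs := ofReal_sqrt_one_sub_sq_mul_self hx
    rw [qsp_succ_zero_zero (2 * m + 1) φ, qsp_succ_one_zero (2 * m + 1) φ, h0, h1]
    simp only [eval_mul, eval_C, eval_add, eval_sub, eval_X]
    constructor
    · linear_combination Complex.exp (Complex.I * φ 0) * Q.eval ((x : ℂ) ^ 2) * hs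
    · ring
  · have hstep : Uᴴ * (BL * A * aeval (Aᴴ * A) P + (U * BR - BL * A) * aeval (Aᴴ * A) Q) =
        BR * aeval (Aᴴ * A) (X * (P - Q) + Q) +
          (Uᴴ * BL * A - BR * (Aᴴ * A)) * aeval (Aᴴ * A) (P - Q) := by
      have hU : Uᴴ * (U * (BR * aeval (Aᴴ * A) Q)) = BR * aeval (Aᴴ * A) Q := by
        rw [← Matrix.mul_assoc, h.conjTranspose_mul_self, Matrix.one_mul]
      simp only [map_add, map_sub, map_mul, aeval_X, Matrix.mul_add, Matrix.mul_sub,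
        Matrix.sub_mul, Matrix.mul_assoc, hU]
      abel
    rw [phasedSequence_two_mul_add_two, Matrix.mul_assoc, Matrix.mul_assoc, hPQ.2, hstep,
      Matrix.mul_add,
      projectorPhase_mul_of_fixed (mul_conjTranspose_self_idem h.right_orthonormal),
      projectorPhase_mul_of_killed (mul_conjTranspose_self_idem h.right_orthonormal)]
    · simp only [map_mul, aeval_C, Algebra.algebraMap_eq_smul_one, Matrix.smul_mul,
        Matrix.mul_smul, Matrix.one_mul]
    · rw [Matrix.mul_assoc, ← Matrix.mul_assoc BRᴴ, h.right_residual, Matrix.zero_mul,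
        Matrix.mul_zero]
    · rw [← Matrix.mul_assoc, mul_conjTranspose_mul_self h.right_orthonormal]

theorem exists_evenForm (h : IsBlockEncoding U A BL BR) (m : ℕ) (φ : ℕ → ℝ) :
    ∃ P Q : ℂ[X], EvenForm U A BL BR (2 * m) φ P Q := by
  induction m generalizing φ with
  | zero => exact ⟨_, _, h.evenForm_zero φ⟩
  | succ m ih =>
    obtain ⟨P, Q, hPQ⟩ := ih fun k => φ (k + 1 + 1)
    exact ⟨_, _, h.evenForm_succ (φ := φ) (h.oddForm_succ hPQ)⟩

theorem exists_oddForm (h : IsBlockEncoding U A BL BR) (m : ℕ) (φ : ℕ → ℝ) :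
    ∃ P Q : ℂ[X], OddForm U A BL BR (2 * m + 1) φ P Q := by
  obtain ⟨P, Q, hPQ⟩ := h.exists_evenForm m fun k => φ (k + 1)
  exact ⟨_, _, h.oddForm_succ hPQ⟩

end IsBlockEncoding

/-! ### Parity -/

/-- At `x = 1` the square root vanishes, and the entry is a product of exponentials. -/
theorem qsp_one_zero_zero_ne_zero (n : ℕ) (φ : ℕ → ℝ) : qsp n φ 1 0 0 ≠ 0 := by
  induction n generalizing φ with
  | zero => simp [qsp, zRotation]
  | succ n ih =>
    rw [qsp_succ_zero_zero]
    simpa using ih _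

/-- Agreement on the infinite set `[-1, 1]` determines a polynomial. This carries the parity from
`[-1, 1]` to all of `ℝ`. -/
theorem Realises.unique {n : ℕ} {φ : ℕ → ℝ} {p q : ℂ[X]} (hp : Realises n φ p)
    (hq : Realises n φ q) : p = q := by
  refine eq_of_infinite_eval_eq p q (Set.Infinite.mono (s := (fun x : ℝ => (x : ℂ)) ''
    Set.Icc (-1 : ℝ) 1) ?_ ?_)
  · rintro _ ⟨x, hx, rfl⟩
    exact (hp x hx).symm.trans (hq x hx)
  · exact (Set.Icc_infinite (by norm_num)).image Complex.ofReal_injective.injOn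

/-- Both parities together would force `p(1) = 0`. This disposes of the implication for the wrong
parity. -/
theorem Realises.not_odd_and_even {n : ℕ} {φ : ℕ → ℝ} {p : ℂ[X]} (hp : Realises n φ p)
    {f : ℝ → ℂ} (hf : f = fun x : ℝ => p.eval (x : ℂ)) (ho : Function.Odd f)
    (he : Function.Even f) : False := by
  apply qsp_one_zero_zero_ne_zero n φ
  rw [hp 1 (by norm_num)]
  have h : f 1 = 0 := CharZero.eq_neg_self_iff.mp ((he 1).symm.trans (ho 1))
  rwa [hf] at h

/-! ### Singular value transforms of `A` and of its extension by zero -/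

theorem aeval_mul_eq_mul_aeval {k l : ℕ} {M : Matrix (Fin k) (Fin k) ℂ}
    {N : Matrix (Fin l) (Fin l) ℂ} {B : Matrix (Fin k) (Fin l) ℂ} (h : M * B = B * N) (q : ℂ[X]) :
    aeval M q * B = B * aeval N q := by
  induction q using Polynomial.induction_on with
  | C a => simp [Algebra.algebraMap_eq_smul_one]
  | add p q hp hq => rw [map_add, map_add, Matrix.add_mul, Matrix.mul_add, hp, hq]
  | monomial n a ih =>
    rw [pow_succ, ← mul_assoc, map_mul, map_mul (aeval N), aeval_X, aeval_X, Matrix.mul_assoc, h,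
      ← Matrix.mul_assoc, ih, Matrix.mul_assoc]

theorem svTransformEven_eq_aeval (A : Matrix (Fin r) (Fin c) ℂ) {f : ℝ → ℂ} {q : ℂ[X]}
    (h : ∀ x : ℝ, f x = q.eval ((x : ℂ) ^ 2)) : svTransformEven f A = aeval (Aᴴ * A) q :=
  SVD.evenTransform_eq_aeval _ fun _ => (h _).symm

theorem svTransformOdd_eq_aeval (A : Matrix (Fin r) (Fin c) ℂ) {f : ℝ → ℂ} {q : ℂ[X]}
    (h : ∀ x : ℝ, f x = x * q.eval ((x : ℂ) ^ 2)) :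
    svTransformOdd f A = A * aeval (Aᴴ * A) q :=
  SVD.oddTransform_eq_aeval _ fun _ => (h _).symm

theorem gram_extend_zero (hL : BLᴴ * BL = 1) :
    (BL * A * BRᴴ)ᴴ * (BL * A * BRᴴ) = BR * (Aᴴ * A) * BRᴴ := by
  have : BLᴴ * (BL * (A * BRᴴ)) = A * BRᴴ := by rw [← Matrix.mul_assoc, hL, Matrix.one_mul]
  simp only [Matrix.conjTranspose_mul, Matrix.conjTranspose_conjTranspose, Matrix.mul_assoc, this]

/-- Only this intertwining is available: `q(BR G BRᴴ)` itself differs from `BR q(G) BRᴴ` by `q(0) (1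
- BR BRᴴ)`. -/
theorem aeval_extend_zero_mul (hR : BRᴴ * BR = 1) (G : Matrix (Fin c) (Fin c) ℂ) (q : ℂ[X]) :
    aeval (BR * G * BRᴴ) q * BR = BR * aeval G q :=
  aeval_mul_eq_mul_aeval (by rw [Matrix.mul_assoc, hR, Matrix.mul_one]) q

theorem mul_aeval_extend_zero (hR : BRᴴ * BR = 1) (G : Matrix (Fin c) (Fin c) ℂ) (q : ℂ[X]) :
    BRᴴ * aeval (BR * G * BRᴴ) q = aeval G q * BRᴴ :=
  (aeval_mul_eq_mul_aeval (by rw [Matrix.mul_assoc, ← Matrix.mul_assoc, hR, Matrix.one_mul]) q).symm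

theorem hasBlockForm_extend_zero (N : Matrix (Fin r) (Fin c) ℂ) (hL : BLᴴ * BL = 1)
    (hR : BRᴴ * BR = 1) : HasBlockForm (BL * N * BRᴴ) N BL BR := by
  intro s t BL₂ BR₂ h₁ h₂
  -- The off-diagonal blocks of the Gram matrix of a completion vanish.
  have orth : ∀ {k l : ℕ} {B : Matrix (Fin d) (Fin k) ℂ} {B₂ : Matrix (Fin d) (Fin l) ℂ},
      IsUnitaryCompletion B B₂ → Bᴴ * B₂ = 0 ∧ B₂ᴴ * B = 0 := by
    intro k l B B₂ h
    have h' := h.1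
    rw [Matrix.conjTranspose_fromCols_eq_fromRows_conjTranspose, Matrix.fromRows_mul_fromCols,
      ← Matrix.fromBlocks_one, Matrix.fromBlocks_inj] at h'
    exact ⟨h'.2.1, h'.2.2.1⟩
  rw [Matrix.conjTranspose_fromCols_eq_fromRows_conjTranspose, Matrix.fromRows_mul,
    Matrix.fromRows_mul_fromCols]
  have e₁ : BLᴴ * (BL * N * BRᴴ) = N * BRᴴ := by
    rw [Matrix.mul_assoc, ← Matrix.mul_assoc, hL, Matrix.one_mul]
  have e₂ : BL₂ᴴ * (BL * N * BRᴴ) = 0 := by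
    rw [Matrix.mul_assoc, ← Matrix.mul_assoc, (orth h₁).2, Matrix.zero_mul]
  rw [e₁, e₂, Matrix.mul_assoc, Matrix.mul_assoc, hR, (orth h₂).1]
  simp

/-! ### The singular value transformation -/

namespace IsBlockEncoding

theorem extend_zero (h : IsBlockEncoding U A BL BR) :
    BL * BLᴴ * U * (BR * BRᴴ) = BL * A * BRᴴ := by
  rw [← h.encodes]
  simp only [Matrix.mul_assoc]

variable {n : ℕ} {φ : ℕ → ℝ} {P Q : ℂ[X]} {f : ℝ → ℂ}

theorem evenForm_transform (h : IsBlockEncoding U A BL BR) (hPQ : EvenForm U A BL BR n φ P Q)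
    (hf : ∀ x : ℝ, f x = P.eval ((x : ℂ) ^ 2)) :
    IsBlockEncoding (phasedSequence U (BL * BLᴴ) (BR * BRᴴ) n φ) (svTransformEven f A) BR BR ∧
    HasBlockForm (BR * BRᴴ * phasedSequence U (BL * BLᴴ) (BR * BRᴴ) n φ * (BR * BRᴴ))
      (svTransformEven f A) BR BR ∧
    BR * BRᴴ * phasedSequence U (BL * BLᴴ) (BR * BRᴴ) n φ * (BR * BRᴴ) =
      BR * BRᴴ * svTransformEven f (BL * BLᴴ * U * (BR * BRᴴ)) * (BR * BRᴴ) := by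
  have henc : IsBlockEncoding (phasedSequence U (BL * BLᴴ) (BR * BRᴴ) n φ)
      (svTransformEven f A) BR BR := by
    refine ⟨phasedSequence_mem_unitaryGroup h.unitary (Matrix.isHermitian_mul_conjTranspose_self _)
      (Matrix.isHermitian_mul_conjTranspose_self _) n φ, h.right_orthonormal,
      h.right_orthonormal, ?_⟩
    rw [Matrix.mul_assoc, hPQ.2, Matrix.mul_add, ← Matrix.mul_assoc, ← Matrix.mul_assoc,
      h.right_residual, h.right_orthonormal, Matrix.one_mul, Matrix.zero_mul, add_zero,
      svTransformEven_eq_aeval A hf]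
  -- `extend_zero` for the new encoding: the projected sequence is `BR f^(SV)(A) BRᴴ`.
  refine ⟨henc, ?_, ?_⟩ <;> rw [henc.extend_zero]
  · exact hasBlockForm_extend_zero _ h.right_orthonormal h.right_orthonormal
  -- The outer projections remove the contribution of `f 0` on the complement of the range of `BR`.
  · rw [svTransformEven_eq_aeval A hf, svTransformEven_eq_aeval _ hf, h.extend_zero,
      gram_extend_zero h.left_orthonormal, Matrix.mul_assoc (BR * BRᴴ), ← Matrix.mul_assoc _ BR,
      aeval_extend_zero_mul h.right_orthonormal, ← Matrix.mul_assoc, ← Matrix.mul_assoc,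
      mul_conjTranspose_mul_self h.right_orthonormal]

theorem oddForm_transform (h : IsBlockEncoding U A BL BR) (hPQ : OddForm U A BL BR n φ P Q)
    (hf : ∀ x : ℝ, f x = x * P.eval ((x : ℂ) ^ 2)) :
    IsBlockEncoding (phasedSequence U (BL * BLᴴ) (BR * BRᴴ) n φ) (svTransformOdd f A) BL BR ∧
    HasBlockForm (BL * BLᴴ * phasedSequence U (BL * BLᴴ) (BR * BRᴴ) n φ * (BR * BRᴴ))
      (svTransformOdd f A) BL BR ∧
    BL * BLᴴ * phasedSequence U (BL * BLᴴ) (BR * BRᴴ) n φ * (BR * BRᴴ) =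
      svTransformOdd f (BL * BLᴴ * U * (BR * BRᴴ)) := by
  have henc : IsBlockEncoding (phasedSequence U (BL * BLᴴ) (BR * BRᴴ) n φ)
      (svTransformOdd f A) BL BR := by
    refine ⟨phasedSequence_mem_unitaryGroup h.unitary (Matrix.isHermitian_mul_conjTranspose_self _)
      (Matrix.isHermitian_mul_conjTranspose_self _) n φ, h.left_orthonormal,
      h.right_orthonormal, ?_⟩
    rw [Matrix.mul_assoc, hPQ.2, Matrix.mul_add, ← Matrix.mul_assoc, ← Matrix.mul_assoc,
      ← Matrix.mul_assoc, h.left_residual, h.left_orthonormal, Matrix.one_mul, Matrix.zero_mul,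
      add_zero, svTransformOdd_eq_aeval A hf]
  refine ⟨henc, ?_, ?_⟩ <;> rw [henc.extend_zero]
  · exact hasBlockForm_extend_zero _ h.left_orthonormal h.right_orthonormal
  -- The factor `BRᴴ` of `BL A BRᴴ` already does the intertwining, so no outer projections are
  -- needed.
  · rw [svTransformOdd_eq_aeval A hf, svTransformOdd_eq_aeval _ hf, h.extend_zero,
      gram_extend_zero h.left_orthonormal, Matrix.mul_assoc (BL * A) BRᴴ,
      mul_aeval_extend_zero h.right_orthonormal]
    simp only [Matrix.mul_assoc]

end IsBlockEncoding

end QSVT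

theorem theorem2p6 {d r c : ℕ} (U : Matrix (Fin d) (Fin d) ℂ) (A : Matrix (Fin r) (Fin c) ℂ)
    (BL : Matrix (Fin d) (Fin r) ℂ) (BR : Matrix (Fin d) (Fin c) ℂ)
    (hU : QSVT.IsBlockEncoding U A BL BR)
    (n : ℕ) (φ : ℕ → ℝ) (p : Polynomial ℂ) (hp : QSVT.Realises n φ p)
    (PL PR UΦ : Matrix (Fin d) (Fin d) ℂ) (hPL : PL = BL * BLᴴ) (hPR : PR = BR * BRᴴ)
    (hUΦ : UΦ = QSVT.phasedSequence U PL PR n φ)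
    (f : ℝ → ℂ) (hf : f = fun x : ℝ => p.eval (x : ℂ)) :
    (Function.Odd f ∨ Function.Even f) ∧
    (Function.Odd f →
      QSVT.IsBlockEncoding UΦ (QSVT.svTransformOdd f A) BL BR ∧
      QSVT.HasBlockForm (PL * UΦ * PR) (QSVT.svTransformOdd f A) BL BR ∧
      PL * UΦ * PR = QSVT.svTransformOdd f (PL * U * PR)) ∧
    (Function.Even f →
      QSVT.IsBlockEncoding UΦ (QSVT.svTransformEven f A) BR BR ∧
      QSVT.HasBlockForm (PR * UΦ * PR) (QSVT.svTransformEven f A) BR BR ∧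
      PR * UΦ * PR = PR * QSVT.svTransformEven f (PL * U * PR) * PR) := by
  subst hPL hPR hUΦ
  rcases Nat.even_or_odd' n with ⟨m, rfl | rfl⟩
  · obtain ⟨P, Q, hPQ⟩ := hU.exists_evenForm m φ
    -- The circuit half of `EvenForm` says that `φ` also realises `P(X²)`.
    have hpP : p = P.comp (Polynomial.X ^ 2) := hp.unique fun x hx => by
      simpa using (hPQ.1 x hx).1
    have hfP : ∀ x : ℝ, f x = P.eval ((x : ℂ) ^ 2) := fun x => by simp [hf, hpP]
    have he : Function.Even f := fun x => by simp [hfP]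
    exact ⟨Or.inr he, fun ho => (hp.not_odd_and_even hf ho he).elim,
      fun _ => hU.evenForm_transform hPQ hfP⟩
  · obtain ⟨P, Q, hPQ⟩ := hU.exists_oddForm m φ
    have hpP : p = Polynomial.X * P.comp (Polynomial.X ^ 2) := hp.unique fun x hx => by
      simpa using (hPQ.1 x hx).1
    have hfP : ∀ x : ℝ, f x = x * P.eval ((x : ℂ) ^ 2) := fun x => by simp [hf, hpP]
    have ho : Function.Odd f := fun x => by simp [hfP]
    exact ⟨Or.inl ho, fun _ => hU.oddForm_transform hPQ hfP,
      fun he => (hp.not_odd_and_even hf ho he).elim⟩
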